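/- Let $N\ge 2$ be an integer and $\beta\in\,]0,\pi[$. Let $\Omega_\beta\subset\mathbb{R}^N$ be the spherical cone of the points $x$ with $0<|x|<1$ whose angle with the positive $x_1$-axis is smaller than $\beta$, and let $C_\beta=\overline{\Omega_\beta}\cap S^{N-1}$ be the corresponding closed spherical cap, with boundary $\partial C_\beta$ in the unit sphere $S^{N-1}$. Let $\delta$ be the Laplace--Beltrami operator on $S^{N-1}$, and let $\Sigma_\beta$ be the set of all real $l>0$ for which the problem $$-\delta\Theta=l(l+N-2)\,\Theta\ \text{ in the interior of } C_\beta,\qquad \Theta=0\ \text{ on }\partial C_\beta,$$ has a real-valued solution $\Theta\not\equiv 0$, continuous on $C_\beta$ and of class $C^2$ in its interior. Then $\Sigma_\beta$ has a minimum, and the characteristic value $l_\beta=\min\Sigma_\beta$ of the cap satisfies: if $\beta\in\,]0,\pi/2[$, then $l_\beta>1$; if $\beta=\pi/2$, then $l_\beta=1$; if $\beta\in\,]\pi/2,\pi[$, then $l_\beta<1$. -/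

import Mathlib

/-- The spherical cone of angle `β` in `ℝ^N`: the points `x` with `0 < r < 1`, where `r = ‖x‖`,
whose angle `θ₁` with the first coordinate axis is smaller than `β`. (For `N = 2` the polar
coordinate `θ₁ ∈ [0, 2π[` then lies in `[0, β[ ∪ ]2π - β, 2π[`.) -/
def sphericalCone (N : ℕ) [NeZero N] (β : ℝ) : Set (EuclideanSpace ℝ (Fin N)) :=
  {x | 0 < ‖x‖ ∧ ‖x‖ < 1 ∧
    InnerProductGeometry.angle (EuclideanSpace.single (0 : Fin N) (1 : ℝ)) x < β}

/-- The spherical cap: the intersection of the closure (in `ℝ^N`) of the cone with the unit sphere,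
as a subset of the sphere, so that its interior and its boundary are taken in the sphere. -/
def sphericalCap (N : ℕ) [NeZero N] (β : ℝ) :
    Set (Metric.sphere (0 : EuclideanSpace ℝ (Fin N)) 1) :=
  {x | (x : EuclideanSpace ℝ (Fin N)) ∈ closure (sphericalCone N β)}

theorem inv_norm_smul_mem_unitSphere {N : ℕ} {x : EuclideanSpace ℝ (Fin N)} (hx : x ≠ 0) :
    ‖x‖⁻¹ • x ∈ Metric.sphere (0 : EuclideanSpace ℝ (Fin N)) 1 := by
  have h : ‖x‖ ≠ 0 := norm_ne_zero_iff.mpr hx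
  rw [mem_sphere_zero_iff_norm, norm_smul, norm_inv, norm_norm, inv_mul_cancel₀ h]

open Classical in
/-- The extension of a function on the unit sphere to `ℝ^N \ {0}` which is constant along rays,
`x ↦ Θ (x / ‖x‖)` (the value at the origin plays no role). -/
noncomputable def radialExtension {N : ℕ}
    (Θ : Metric.sphere (0 : EuclideanSpace ℝ (Fin N)) 1 → ℝ) (x : EuclideanSpace ℝ (Fin N)) : ℝ :=
  if hx : x ≠ 0 then Θ ⟨‖x‖⁻¹ • x, inv_norm_smul_mem_unitSphere hx⟩ else 0

/-- The Laplace-Beltrami operator `δ` of the unit sphere of `ℝ^N`. In spherical coordinates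
`Δ f = ∂²f/∂r² + ((N - 1) / r) ∂f/∂r + (1 / r²) δ f`, so `δ Θ` is the value at `r = 1` of the
Euclidean Laplacian of the extension of `Θ` which does not depend on `r`. -/
noncomputable def sphereLaplacian {N : ℕ}
    (Θ : Metric.sphere (0 : EuclideanSpace ℝ (Fin N)) 1 → ℝ)
    (x : Metric.sphere (0 : EuclideanSpace ℝ (Fin N)) 1) : ℝ :=
  Laplacian.laplacian (radialExtension Θ) (x : EuclideanSpace ℝ (Fin N))

/-- `Θ` is a nontrivial (classical) solution of `-δ Θ = l (l + N - 2) Θ` in the spherical cap, with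
`Θ = 0` on the boundary of the cap: it is continuous on the cap and of class `C²` in its interior
(a function on the sphere is `C²` near a point iff its extension along rays is). -/
structure IsCapDirichletSolution (N : ℕ) [NeZero N] (β l : ℝ)
    (Θ : Metric.sphere (0 : EuclideanSpace ℝ (Fin N)) 1 → ℝ) : Prop where
  continuousOn : ContinuousOn Θ (sphericalCap N β)
  contDiffAt : ∀ x ∈ interior (sphericalCap N β),
    ContDiffAt ℝ 2 (radialExtension Θ) (x : EuclideanSpace ℝ (Fin N))
  equation : ∀ x ∈ interior (sphericalCap N β),
    -sphereLaplacian Θ x = l * (l + (N : ℝ) - 2) * Θ x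
  boundary : ∀ x ∈ frontier (sphericalCap N β), Θ x = 0
  nontrivial : ∃ x ∈ sphericalCap N β, Θ x ≠ 0

/-- The set `Σ_β` of the positive `l` for which a nontrivial solution exists. -/
def capExponents (N : ℕ) [NeZero N] (β : ℝ) : Set ℝ :=
  {l | 0 < l ∧ ∃ Θ, IsCapDirichletSolution N β l Θ}

/-- The characteristic value `l_β` of the spherical cap: the minimum of `Σ_β`
(the infimum here; that it is attained is a matter of proof). -/
noncomputable def capCharacteristicValue (N : ℕ) [NeZero N] (β : ℝ) : ℝ :=
  sInf (capExponents N β)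

/-! A function of `s = (1 - x₁) / 2` alone solves the eigenvalue equation with eigenvalue `μ`
exactly when its profile `G` satisfies `s (1 - s) G'' + c (1 - 2 s) G' + μ G = 0`, where `c = (N -
1) / 2`. Take the power series solution with `G 0 = 1`, and put `b = (1 - cos β) / 2`, the value of
`s` on the boundary of the cap. There is a least `μ₀` for which the profile vanishes on `[0, b]`; it
then vanishes only at `b` (`exists_first_eigenvalue`). The positive `l₀` with `l₀ (l₀ + N - 2) = μ₀`
therefore belongs to `Σ_β`.

No smaller `l` does, even with a non-zonal solution `Θ`. For `μ` strictly between the eigenvalue of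
`Θ` and `μ₀`, the profile gives a positive `Φ` on the closed cap. At a positive maximum of `Θ / Φ`,
with value `m`, the difference `Θ - m Φ` has a local maximum but a positive Laplacian
(`IsCapDirichletSolution.false_of_barrier`). No spectral theory is needed.

The trichotomy compares `μ₀` with `2 c = N - 1`, the eigenvalue of `l = 1`, whose profile is `1 - 2
s = x₁` and vanishes at `s = 1 / 2`, i.e. at `β = π / 2`. Sturm comparison
(`capProfile_ne_zero_of_lt`) and the minimality of `μ₀` decide the sign of `μ₀ - 2 c`. -/

open Set Filter Topology

/-! ### Power series on `]-1, 1[` -/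

/-- The sum of the power series with coefficients `a`. -/
noncomputable def powSum (a : ℕ → ℝ) (s : ℝ) : ℝ := ∑' k, a k * s ^ k

/-- The power series with coefficients `a` converges absolutely on `]-1, 1[`. -/
def SummableInUnitDisc (a : ℕ → ℝ) : Prop :=
  ∀ r : ℝ, 0 ≤ r → r < 1 → Summable fun k => |a k| * r ^ k

/-- The coefficients of the derived power series. -/
def derivCoeff (a : ℕ → ℝ) (k : ℕ) : ℝ := (k + 1) * a (k + 1)

namespace SummableInUnitDisc

variable {a : ℕ → ℝ}

theorem summable (ha : SummableInUnitDisc a) {s : ℝ} (hs : |s| < 1) :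
    Summable fun k => a k * s ^ k := by
  refine Summable.of_norm ?_
  simpa [abs_mul, abs_pow] using ha |s| (abs_nonneg s) hs

/-- For `r < ρ < 1` the factor `(k + 1) (r / ρ) ^ k` is bounded, so the derived series at `r` is
dominated by the original one at `ρ`. -/
theorem derivCoeff (ha : SummableInUnitDisc a) : SummableInUnitDisc (derivCoeff a) := by
  intro r hr0 hr1
  obtain ⟨ρ, hrρ, hρ1⟩ := exists_between hr1
  have hρ0 : 0 < ρ := hr0.trans_lt hrρ
  have hq0 : 0 ≤ r / ρ := by positivity
  have hq1 : r / ρ < 1 := (div_lt_one hρ0).2 hrρ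
  have ht : Tendsto (fun k : ℕ => (k : ℝ) * (r / ρ) ^ k + (r / ρ) ^ k) atTop (𝓝 (0 + 0)) :=
    (tendsto_self_mul_const_pow_of_lt_one hq0 hq1).add (tendsto_pow_atTop_nhds_zero_of_lt_one hq0 hq1)
  obtain ⟨C, hC⟩ := ht.bddAbove_range
  have hsum := ((summable_nat_add_iff 1).2 (ha ρ hρ0.le hρ1)).mul_left (C / ρ)
  refine Summable.of_nonneg_of_le (fun k => by positivity) (fun k => ?_) hsum
  have hk : (k : ℝ) * (r / ρ) ^ k + (r / ρ) ^ k ≤ C := hC ⟨k, rfl⟩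
  have h1 : r ^ k = (r / ρ) ^ k * ρ ^ k := by rw [← mul_pow, div_mul_cancel₀ _ hρ0.ne']
  have h2 : C / ρ * (|a (k + 1)| * ρ ^ (k + 1)) = C * (|a (k + 1)| * ρ ^ k) := by
    field_simp
    ring
  have h3 : |_root_.derivCoeff a k| = (k + 1) * |a (k + 1)| := by
    rw [_root_.derivCoeff, abs_mul, abs_of_nonneg (by positivity)]
  rw [h2, h3, h1]
  have h4 : 0 ≤ |a (k + 1)| * ρ ^ k := by positivity
  nlinarith [mul_le_mul_of_nonneg_right hk h4]

theorem hasDerivAt (ha : SummableInUnitDisc a) {s : ℝ} (hs : |s| < 1) :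
    HasDerivAt (powSum a) (powSum (_root_.derivCoeff a) s) s := by
  obtain ⟨r, hsr, hr1⟩ := exists_between hs
  have hr0 : 0 ≤ r := (abs_nonneg s).trans hsr.le
  have hu : Summable fun k : ℕ => |a k| * (k * r ^ (k - 1)) := by
    rw [← summable_nat_add_iff 1]
    refine (ha.derivCoeff r hr0 hr1).congr fun k => ?_
    rw [_root_.derivCoeff, abs_mul, abs_of_nonneg (by positivity : (0 : ℝ) ≤ k + 1)]
    push_cast
    ring
  have h := hasDerivAt_tsum_of_isPreconnected (g := fun k y => a k * y ^ k)
    (g' := fun k y => a k * (k * y ^ (k - 1))) (t := Ioo (-r) r) (y₀ := s) (y := s) hu isOpen_Ioo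
    isPreconnected_Ioo (fun k y _ => (hasDerivAt_pow k y).const_mul _) (fun k y hy => ?_)
    (abs_lt.1 hsr) (ha.summable hs) (abs_lt.1 hsr)
  · have h0 : (∑' k : ℕ, a k * (k * s ^ (k - 1))) = powSum (_root_.derivCoeff a) s := by
      rw [Summable.tsum_eq_zero_add, powSum]
      · simp only [Nat.cast_zero, zero_mul, mul_zero, zero_add, _root_.derivCoeff]
        refine tsum_congr fun k => ?_
        push_cast
        ring
      · rw [← summable_nat_add_iff 1]
        refine (ha.derivCoeff.summable hs).congr fun k => ?_
        rw [_root_.derivCoeff]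
        push_cast
        ring
    rw [h0] at h
    exact h
  · have hy' : |y| ≤ r := (abs_lt.2 hy).le
    rw [Real.norm_eq_abs, abs_mul, abs_mul, abs_pow, Nat.abs_cast]
    gcongr

theorem contDiffOn (n : ℕ) : ∀ {a : ℕ → ℝ}, SummableInUnitDisc a →
    ContDiffOn ℝ n (powSum a) (Ioo (-1) 1) := by
  induction n with
  | zero =>
    intro a ha
    rw [Nat.cast_zero, contDiffOn_zero]
    exact fun s hs => (ha.hasDerivAt (abs_lt.2 hs)).continuousAt.continuousWithinAt
  | succ n ih =>
    intro a ha
    rw [Nat.cast_succ, contDiffOn_succ_iff_deriv_of_isOpen isOpen_Ioo]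
    refine ⟨fun s hs => (ha.hasDerivAt (abs_lt.2 hs)).differentiableAt.differentiableWithinAt,
      by simp, (ih ha.derivCoeff).congr fun s hs => (ha.hasDerivAt (abs_lt.2 hs)).deriv⟩

theorem hasSum_mul_powSum_derivCoeff (ha : SummableInUnitDisc a) {s : ℝ} (hs : |s| < 1) :
    HasSum (fun k : ℕ => k * a k * s ^ k) (s * powSum (_root_.derivCoeff a) s) := by
  rw [← hasSum_nat_add_iff' 1]
  have h := (ha.derivCoeff.summable hs).hasSum.mul_left s
  simp only [Finset.range_one, Finset.sum_singleton, Nat.cast_zero, zero_mul, sub_zero]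
  refine h.congr_fun fun k => ?_
  rw [_root_.derivCoeff]
  push_cast
  ring

end SummableInUnitDisc

/-! ### The zonal profile as a hypergeometric series -/

/-- The Taylor coefficients at `s = 0` of the regular solution of
`s (1 - s) G'' + c (1 - 2 s) G' + μ G = 0`. -/
noncomputable def capCoeff (c μ : ℝ) : ℕ → ℝ
  | 0 => 1
  | k + 1 => capCoeff c μ k * ((k * (k + 2 * c - 1) - μ) / ((k + 1) * (k + c)))

/-- The solution of `s (1 - s) G'' + c (1 - 2 s) G' + μ G = 0` which is regular at `s = 0` and
takes the value `1` there: a zonal function on the sphere of dimension `2 c`, in the variable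
`s = (1 - cos θ) / 2`. -/
noncomputable def capProfile (c μ : ℝ) : ℝ → ℝ := powSum (capCoeff c μ)

/-- The first derivative of `capProfile`. -/
noncomputable def capProfileDeriv (c μ : ℝ) : ℝ → ℝ := powSum (derivCoeff (capCoeff c μ))

/-- The second derivative of `capProfile`. -/
noncomputable def capProfileDeriv₂ (c μ : ℝ) : ℝ → ℝ :=
  powSum (derivCoeff (derivCoeff (capCoeff c μ)))

section capProfile

variable {c μ : ℝ}

theorem capCoeff_succ (k : ℕ) : capCoeff c μ (k + 1) =
    capCoeff c μ k * ((k * (k + 2 * c - 1) - μ) / ((k + 1) * (k + c))) := rfl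

theorem natCast_mul_add_nonneg (hc : 1 / 2 ≤ c) (k : ℕ) : 0 ≤ (k : ℝ) * (k + 2 * c - 1) :=
  mul_nonneg (Nat.cast_nonneg k) (by have := Nat.cast_nonneg (α := ℝ) k; linarith)

theorem summableInUnitDisc_capCoeff (hc : 1 / 2 ≤ c) (μ : ℝ) :
    SummableInUnitDisc (capCoeff c μ) := by
  intro r hr0 hr1
  -- The ratio of consecutive terms tends to `r`. This threshold gives `k² r + (2 c + |μ|) k ≤ k² (1
  -- + r) / 2`, hence the ratio bound `(1 + r) / 2 < 1`.
  have hev : ∀ᶠ k : ℕ in atTop, 1 ≤ (k : ℝ) ∧ 2 * (2 * c + |μ|) / (1 - r) ≤ k :=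
    (tendsto_natCast_atTop_atTop.eventually_ge_atTop 1).and
      (tendsto_natCast_atTop_atTop.eventually_ge_atTop _)
  refine summable_of_ratio_norm_eventually_le (r := (1 + r) / 2) (by linarith) ?_
  filter_upwards [hev] with k hk
  obtain ⟨hk1, hk2⟩ := hk
  rw [div_le_iff₀ (by linarith)] at hk2
  have hd : 0 < ((k : ℝ) + 1) * (k + c) := by positivity
  have hratio : |((k : ℝ) * (k + 2 * c - 1) - μ) / ((k + 1) * (k + c))| * r ≤ (1 + r) / 2 := by
    rw [abs_div, abs_of_pos hd, div_mul_eq_mul_div, div_le_iff₀ hd]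
    have h1 : |(k : ℝ) * (k + 2 * c - 1) - μ| ≤ k * (k + 2 * c - 1) + |μ| := by
      refine (abs_sub _ _).trans ?_
      rw [abs_of_nonneg (natCast_mul_add_nonneg hc k)]
    have h2 := mul_le_mul_of_nonneg_right h1 hr0
    have h3 : ((k : ℝ) * (k + 2 * c - 1) + |μ|) * r ≤ k ^ 2 * r + (2 * c + |μ|) * k := by
      have hμ := abs_nonneg μ
      have e1 : (k : ℝ) * (2 * c - 1) * r ≤ k * (2 * c - 1) * 1 :=
        mul_le_mul_of_nonneg_left hr1.le (mul_nonneg (by linarith) (by linarith))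
      have e2 : |μ| * r ≤ |μ| * k := mul_le_mul_of_nonneg_left (by linarith) hμ
      nlinarith
    have h4 := mul_le_mul_of_nonneg_right hk2 (by linarith : (0 : ℝ) ≤ k)
    have h5 : (1 + r) / 2 * (k : ℝ) ^ 2 ≤ (1 + r) / 2 * ((k + 1) * (k + c)) := by
      refine mul_le_mul_of_nonneg_left ?_ (by linarith)
      nlinarith
    nlinarith
  simp only [capCoeff_succ, norm_mul, norm_pow, Real.norm_eq_abs, abs_abs, abs_mul,
    abs_of_nonneg hr0, pow_succ]
  have h0 : 0 ≤ |capCoeff c μ k| * r ^ k := by positivity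
  calc _ = |capCoeff c μ k| * r ^ k *
        (|((k : ℝ) * (k + 2 * c - 1) - μ) / ((k + 1) * (k + c))| * r) := by ring
    _ ≤ |capCoeff c μ k| * r ^ k * ((1 + r) / 2) := mul_le_mul_of_nonneg_left hratio h0
    _ = _ := by ring

theorem hasDerivAt_capProfile (hc : 1 / 2 ≤ c) {s : ℝ} (hs : |s| < 1) :
    HasDerivAt (capProfile c μ) (capProfileDeriv c μ s) s :=
  (summableInUnitDisc_capCoeff hc μ).hasDerivAt hs

theorem hasDerivAt_capProfileDeriv (hc : 1 / 2 ≤ c) {s : ℝ} (hs : |s| < 1) :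
    HasDerivAt (capProfileDeriv c μ) (capProfileDeriv₂ c μ s) s :=
  (summableInUnitDisc_capCoeff hc μ).derivCoeff.hasDerivAt hs

theorem contDiffAt_capProfile (hc : 1 / 2 ≤ c) {s : ℝ} (hs : |s| < 1) :
    ContDiffAt ℝ 2 (capProfile c μ) s :=
  (SummableInUnitDisc.contDiffOn 2 (summableInUnitDisc_capCoeff hc μ)).contDiffAt
    (isOpen_Ioo.mem_nhds (abs_lt.1 hs))

theorem capProfile_zero : capProfile c μ 0 = 1 := by
  rw [capProfile, powSum, tsum_eq_single 0]
  · simp [capCoeff]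
  · intro k hk
    simp [hk]

theorem capProfile_ode (hc : 1 / 2 ≤ c) {s : ℝ} (hs : |s| < 1) :
    s * (1 - s) * capProfileDeriv₂ c μ s + c * (1 - 2 * s) * capProfileDeriv c μ s +
      μ * capProfile c μ s = 0 := by
  have ha := summableInUnitDisc_capCoeff hc μ
  have h0 := (ha.summable hs).hasSum
  have h1 := (ha.derivCoeff.summable hs).hasSum
  have h2 := ha.hasSum_mul_powSum_derivCoeff hs
  have h3 := ha.derivCoeff.hasSum_mul_powSum_derivCoeff hs
  have h4 : HasSum (fun k : ℕ => (k : ℝ) * (k - 1) * capCoeff c μ k * s ^ k)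
      (s * (s * capProfileDeriv₂ c μ s)) := by
    rw [← hasSum_nat_add_iff' 1]
    simp only [Finset.range_one, Finset.sum_singleton, Nat.cast_zero, zero_mul, sub_zero]
    refine (h3.mul_left s).congr_fun fun k => ?_
    rw [derivCoeff]
    push_cast
    ring
  -- The left side of the equation as a single power series; the recursion for `capCoeff` makes each
  -- of its coefficients zero.
  have h := (((h3.sub h4).add (h1.mul_left c)).sub (h2.mul_left (2 * c))).add (h0.mul_left μ)
  have hz := h.congr_fun (g := fun _ : ℕ => (0 : ℝ)) fun k => ?_
  · have := hz.unique hasSum_zero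
    simp only [capProfile, capProfileDeriv, capProfileDeriv₂, powSum] at this ⊢
    linear_combination this
  · have hk : (0 : ℝ) ≤ k := Nat.cast_nonneg k
    have e1 : (k : ℝ) + 1 ≠ 0 := by positivity
    have e2 : (k : ℝ) + c ≠ 0 := by positivity
    simp only [derivCoeff, capCoeff_succ]
    field_simp
    ring

theorem continuous_capCoeff (c : ℝ) (k : ℕ) : Continuous fun μ => capCoeff c μ k := by
  induction k with
  | zero => exact continuous_const
  | succ k ih =>
    simp only [capCoeff_succ]
    fun_prop

/-- At `-M` every factor of the recursion has the nonnegative numerator `k (k + 2 c - 1) + M`, which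
dominates the numerators for all `|μ| ≤ M`. The resulting majorant, uniform in `μ`, yields joint
continuity in `(μ, s)`. -/
theorem abs_capCoeff_le (hc : 1 / 2 ≤ c) {M : ℝ} (hμ : |μ| ≤ M) (k : ℕ) :
    |capCoeff c μ k| ≤ |capCoeff c (-M) k| := by
  induction k with
  | zero => simp [capCoeff]
  | succ k ih =>
    have hd : 0 < ((k : ℝ) + 1) * (k + c) := by positivity
    have hM : 0 ≤ M := (abs_nonneg μ).trans hμ
    have hk := natCast_mul_add_nonneg hc k
    rw [capCoeff_succ, capCoeff_succ, abs_mul, abs_mul, abs_div, abs_div]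
    refine mul_le_mul ih (div_le_div_of_nonneg_right ?_ (abs_nonneg _)) (by positivity) (abs_nonneg _)
    rw [sub_neg_eq_add, abs_of_nonneg (by positivity : (0 : ℝ) ≤ k * (k + 2 * c - 1) + M)]
    refine (abs_sub _ _).trans ?_
    rw [abs_of_nonneg hk]
    linarith

theorem continuousOn_capProfile_prod (hc : 1 / 2 ≤ c) {M r : ℝ} (hr0 : 0 ≤ r) (hr1 : r < 1) :
    ContinuousOn (fun p : ℝ × ℝ => capProfile c p.1 p.2) (Icc (-M) M ×ˢ Icc (-r) r) := by
  refine continuousOn_tsum (u := fun k => |capCoeff c (-M) k| * r ^ k) (fun k => ?_)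
    (summableInUnitDisc_capCoeff hc (-M) r hr0 hr1) fun k p hp => ?_
  · exact (((continuous_capCoeff c k).comp continuous_fst).mul
      (continuous_snd.pow k)).continuousOn
  · rw [norm_mul, norm_pow, Real.norm_eq_abs, Real.norm_eq_abs]
    have h1 := abs_capCoeff_le hc (abs_le.2 hp.1) k
    have h2 : |p.2| ≤ r := abs_le.2 hp.2
    gcongr

/-- The recursion terminates: at `k = 1` its numerator is `2 c - 2 c = 0`. This is the profile of
the coordinate `x₁`, the reference solution for the half-sphere. -/
theorem capProfile_two_mul (hc : 1 / 2 ≤ c) (s : ℝ) : capProfile c (2 * c) s = 1 - 2 * s := by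
  have h1 : capCoeff c (2 * c) 1 = -2 := by
    have : c ≠ 0 := by positivity
    simp only [capCoeff]
    field_simp
    norm_num
  have h2 : ∀ k : ℕ, capCoeff c (2 * c) (k + 2) = 0 := by
    intro k
    induction k with
    | zero => rw [zero_add, capCoeff_succ]; simp
    | succ k ih => rw [show k + 1 + 2 = (k + 2) + 1 from rfl, capCoeff_succ, ih, zero_mul]
  rw [capProfile, powSum, tsum_eq_sum (s := Finset.range 2)]
  · rw [Finset.sum_range_succ, Finset.sum_range_one, h1]
    simp [capCoeff]
    ring
  · intro k hk
    obtain ⟨j, rfl⟩ := Nat.exists_eq_add_of_le' (not_lt.1 (mt Finset.mem_range.2 hk))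
    rw [h2, zero_mul]

theorem capProfile_eigenvalue_zero (c s : ℝ) : capProfile c 0 s = 1 := by
  have h : ∀ k : ℕ, capCoeff c 0 (k + 1) = 0 := by
    intro k
    induction k with
    | zero => rw [capCoeff_succ]; simp
    | succ k ih => rw [capCoeff_succ, ih, zero_mul]
  rw [capProfile, powSum, tsum_eq_single 0]
  · simp [capCoeff]
  · intro k hk
    obtain ⟨j, rfl⟩ := Nat.exists_eq_succ_of_ne_zero hk
    rw [h, zero_mul]

end capProfile

/-! ### Sturm-Liouville theory and the first zonal eigenvalue -/

/-- The derivative of the zonal profile times the Sturm-Liouville weight `(s (1 - s)) ^ c`. -/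
noncomputable def capFlux (c μ s : ℝ) : ℝ := (s * (1 - s)) ^ c * capProfileDeriv c μ s

section capFlux

variable {c μ s : ℝ}

theorem hasDerivAt_weight (c : ℝ) (hs : s ∈ Ioo (0 : ℝ) 1) :
    HasDerivAt (fun s : ℝ => (s * (1 - s)) ^ c) (c * (1 - 2 * s) * (s * (1 - s)) ^ (c - 1)) s := by
  have h0 : s * (1 - s) ≠ 0 := (mul_pos hs.1 (sub_pos.2 hs.2)).ne'
  have h1 : HasDerivAt (fun s : ℝ => s * (1 - s)) (1 - 2 * s) s := by
    have h := (hasDerivAt_id s).mul ((hasDerivAt_id s).const_sub 1)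
    refine h.congr_deriv ?_
    simp only [id]
    ring
  refine (h1.rpow_const (p := c) (Or.inl h0)).congr_deriv ?_
  ring

/-- This is the differential equation in divergence form, multiplied by `(s (1 - s)) ^ (c - 1)`. -/
theorem hasDerivAt_capFlux (hc : 1 / 2 ≤ c) (hs : s ∈ Ioo (0 : ℝ) 1) :
    HasDerivAt (capFlux c μ) (-(μ * (s * (1 - s)) ^ (c - 1) * capProfile c μ s)) s := by
  have hs' : |s| < 1 := abs_lt.2 ⟨by linarith [hs.1], hs.2⟩
  have hpos : 0 < s * (1 - s) := mul_pos hs.1 (sub_pos.2 hs.2)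
  refine ((hasDerivAt_weight c hs).mul (hasDerivAt_capProfileDeriv hc hs')).congr_deriv ?_
  have h1 : (s * (1 - s)) ^ c = (s * (1 - s)) ^ (c - 1) * (s * (1 - s)) := by
    rw [← Real.rpow_add_one hpos.ne', sub_add_cancel]
  rw [h1]
  linear_combination (s * (1 - s)) ^ (c - 1) * capProfile_ode (μ := μ) hc hs'

theorem continuousOn_capProfile (hc : 1 / 2 ≤ c) : ContinuousOn (capProfile c μ) (Ico 0 1) :=
  fun _ hs => (hasDerivAt_capProfile hc
    (abs_lt.2 ⟨by linarith [hs.1], hs.2⟩)).continuousAt.continuousWithinAt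

theorem continuousOn_capFlux (hc : 1 / 2 ≤ c) : ContinuousOn (capFlux c μ) (Ico 0 1) := by
  refine ContinuousOn.mul (Continuous.continuousOn ?_) fun s hs => ?_
  · exact Continuous.rpow_const (by fun_prop) fun _ => Or.inr (by linarith)
  · exact (hasDerivAt_capProfileDeriv hc
      (abs_lt.2 ⟨by linarith [hs.1], hs.2⟩)).continuousAt.continuousWithinAt

theorem capFlux_zero (hc : 1 / 2 ≤ c) : capFlux c μ 0 = 0 := by
  have hc' : c ≠ 0 := by positivity
  rw [capFlux, zero_mul, Real.zero_rpow hc', zero_mul]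

theorem antitoneOn_capFlux (hc : 1 / 2 ≤ c) (hμ : 0 ≤ μ) {b : ℝ} (hb : b < 1)
    (hG : ∀ s ∈ Icc 0 b, 0 ≤ capProfile c μ s) : AntitoneOn (capFlux c μ) (Icc 0 b) := by
  have hsub : ∀ {s}, s ∈ interior (Icc 0 b) → s ∈ Ioo (0 : ℝ) 1 := fun {s} hs => by
    rw [interior_Icc] at hs
    exact ⟨hs.1, hs.2.trans hb⟩
  refine antitoneOn_of_deriv_nonpos (convex_Icc 0 b)
    ((continuousOn_capFlux hc).mono (Icc_subset_Ico_right hb))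
    (fun s hs => (hasDerivAt_capFlux hc (hsub hs)).differentiableAt.differentiableWithinAt)
    fun s hs => ?_
  rw [(hasDerivAt_capFlux hc (hsub hs)).deriv]
  have h1 := hG s (interior_subset hs)
  have h2 : 0 < s * (1 - s) := mul_pos (hsub hs).1 (sub_pos.2 (hsub hs).2)
  have h3 : 0 ≤ μ * (s * (1 - s)) ^ (c - 1) * capProfile c μ s := by positivity
  linarith

/-- The flux is `0` at `0` and strictly decreases near it because the profile starts at `1`;
afterwards it cannot increase while the profile is nonnegative. -/
theorem capFlux_neg (hc : 1 / 2 ≤ c) (hμ : 0 < μ) {b : ℝ} (hb0 : 0 < b) (hb : b < 1)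
    (hG : ∀ s ∈ Icc 0 b, 0 ≤ capProfile c μ s) : capFlux c μ b < 0 := by
  have h0 : ∀ᶠ s in 𝓝 (0 : ℝ), 0 < capProfile c μ s :=
    (hasDerivAt_capProfile hc (by simp)).continuousAt.eventually
      (lt_mem_nhds (by rw [capProfile_zero]; exact one_pos))
  obtain ⟨ε, hε, hpos⟩ := Metric.eventually_nhds_iff.1 h0
  obtain ⟨δ, hδ0, hδ⟩ := exists_between (lt_min hε hb0)
  have hδb : δ < b := hδ.trans_le (min_le_right _ _)
  have hstrict : StrictAntiOn (capFlux c μ) (Icc 0 δ) := by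
    refine strictAntiOn_of_deriv_neg (convex_Icc 0 δ)
      ((continuousOn_capFlux hc).mono (Icc_subset_Ico_right (hδb.trans hb))) fun s hs => ?_
    rw [interior_Icc] at hs
    have hs1 : s < 1 := hs.2.trans (hδb.trans hb)
    rw [(hasDerivAt_capFlux hc ⟨hs.1, hs1⟩).deriv]
    have h1 : 0 < capProfile c μ s := hpos (by
      rw [Real.dist_eq, sub_zero, abs_of_pos hs.1]
      exact hs.2.trans (hδ.trans_le (min_le_left _ _)))
    have h2 : 0 < s * (1 - s) := mul_pos hs.1 (sub_pos.2 hs1)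
    have h3 : 0 < μ * (s * (1 - s)) ^ (c - 1) * capProfile c μ s := by positivity
    linarith
  have h1 := hstrict (left_mem_Icc.2 hδ0.le) (right_mem_Icc.2 hδ0.le) hδ0
  have h2 := antitoneOn_capFlux hc hμ.le hb hG ⟨hδ0.le, hδb.le⟩ (right_mem_Icc.2 hb0.le) hδb.le
  rw [capFlux_zero hc] at h1
  linarith

theorem capProfileDeriv_neg (hc : 1 / 2 ≤ c) (hμ : 0 < μ) {b : ℝ} (hb0 : 0 < b) (hb : b < 1)
    (hG : ∀ s ∈ Icc 0 b, 0 ≤ capProfile c μ s) : capProfileDeriv c μ b < 0 := by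
  have h := capFlux_neg hc hμ hb0 hb hG
  have hpos : 0 < b * (1 - b) := mul_pos hb0 (sub_pos.2 hb)
  exact (pos_iff_neg_of_mul_neg h).1 (by positivity)

theorem strictAntiOn_capProfile (hc : 1 / 2 ≤ c) (hμ : 0 < μ) {b : ℝ} (hb : b < 1)
    (hG : ∀ s ∈ Icc 0 b, 0 ≤ capProfile c μ s) : StrictAntiOn (capProfile c μ) (Icc 0 b) := by
  refine strictAntiOn_of_deriv_neg (convex_Icc 0 b)
    ((continuousOn_capProfile hc).mono (Icc_subset_Ico_right hb)) fun s hs => ?_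
  rw [interior_Icc] at hs
  have hs1 : s < 1 := hs.2.trans hb
  rw [(hasDerivAt_capProfile hc (abs_lt.2 ⟨by linarith [hs.1], hs1⟩)).deriv]
  exact capProfileDeriv_neg hc hμ hs.1 hs1 fun t ht => hG t ⟨ht.1, ht.2.trans hs.2.le⟩

/-- For a large eigenvalue the profile changes sign on any given interval `[0, b]`. -/
theorem exists_capProfile_nonpos (hc : 1 / 2 ≤ c) {b : ℝ} (hb0 : 0 < b) (hb : b < 1) :
    ∃ μ, 0 < μ ∧ ∃ s ∈ Icc 0 b, capProfile c μ s ≤ 0 := by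
  have hcomp : IsCompact (Icc (b / 4) (b / 2)) := isCompact_Icc
  have hne : (Icc (b / 4) (b / 2)).Nonempty := nonempty_Icc.2 (by linarith)
  have hwpos : ∀ {s : ℝ}, s ∈ Icc (b / 4) (b / 2) → 0 < s * (1 - s) := fun {s} hs =>
    mul_pos (by linarith [hs.1]) (by linarith [hs.2])
  obtain ⟨s₀, hs₀, hmin⟩ := hcomp.exists_isMinOn hne (f := fun s : ℝ => (s * (1 - s)) ^ (c - 1))
    (ContinuousOn.rpow_const (by fun_prop) fun s hs => Or.inl (hwpos hs).ne')
  set m := (s₀ * (1 - s₀)) ^ (c - 1) with hm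
  have hm0 : 0 < m := Real.rpow_pos_of_pos (hwpos hs₀) _
  -- If the profile stayed positive, with value `g` at `b / 2`, the flux would fall by at least `μ m
  -- g b / 4` on `[b / 4, b / 2]`, so the profile would fall by at least `μ m g b² / 8` on `[b / 2,
  -- b]`. The constant `8` makes this drop equal to `g`, contradicting positivity at `b`.
  refine ⟨8 / (m * b ^ 2), by positivity, ?_⟩
  by_contra! hG
  set μ := 8 / (m * b ^ 2) with hμdef
  have hμ : 0 < μ := by positivity
  have hG' : ∀ s ∈ Icc 0 b, 0 ≤ capProfile c μ s := fun s hs => (hG s hs).le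
  have hanti := (strictAntiOn_capProfile hc hμ hb hG').antitoneOn
  have hflux := antitoneOn_capFlux hc hμ.le hb hG'
  have hmid : b / 2 ∈ Icc 0 b := ⟨by linarith, by linarith⟩
  set g := capProfile c μ (b / 2) with hg
  have hg0 : 0 < g := hG _ hmid
  have h1 : capFlux c μ (b / 2) - capFlux c μ (b / 4) ≤ -(μ * m * g) * (b / 2 - b / 4) := by
    refine (convex_Icc (b / 4) (b / 2)).image_sub_le_mul_sub_of_deriv_le
      ((continuousOn_capFlux hc).mono fun s hs => ⟨by linarith [hs.1], by linarith [hs.2]⟩)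
      (fun s hs => ?_) (fun s hs => ?_) _ (left_mem_Icc.2 (by linarith)) _
      (right_mem_Icc.2 (by linarith)) (by linarith)
    · rw [interior_Icc] at hs
      exact (hasDerivAt_capFlux hc
        ⟨by linarith [hs.1], by linarith [hs.2]⟩).differentiableAt.differentiableWithinAt
    · have hs' := interior_subset hs
      rw [(hasDerivAt_capFlux hc ⟨by linarith [hs'.1], by linarith [hs'.2]⟩).deriv]
      have e1 : m ≤ (s * (1 - s)) ^ (c - 1) := hmin hs'
      have e2 : g ≤ capProfile c μ s :=
        hanti ⟨by linarith [hs'.1], by linarith [hs'.2]⟩ hmid hs'.2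
      have e0 : 0 < s * (1 - s) := hwpos hs'
      have e3 : μ * m * g ≤ μ * (s * (1 - s)) ^ (c - 1) * capProfile c μ s := by gcongr
      linarith
  have h2 : capFlux c μ (b / 4) ≤ 0 :=
    (capFlux_neg hc hμ (by linarith) (by linarith)
      fun s hs => hG' s ⟨hs.1, by linarith [hs.2]⟩).le
  have h3 : capProfile c μ b - g ≤ capFlux c μ (b / 2) * (b - b / 2) := by
    refine (convex_Icc (b / 2) b).image_sub_le_mul_sub_of_deriv_le
      ((continuousOn_capProfile hc).mono fun s hs => ⟨by linarith [hs.1], by linarith [hs.2]⟩)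
      (fun s hs => ?_) (fun s hs => ?_) _ (left_mem_Icc.2 (by linarith)) _
      (right_mem_Icc.2 (by linarith)) (by linarith)
    · rw [interior_Icc] at hs
      exact (hasDerivAt_capProfile hc (abs_lt.2
        ⟨by linarith [hs.1], by linarith [hs.2]⟩)).differentiableAt.differentiableWithinAt
    · have hs' := interior_subset hs
      have hs0 : 0 < s := by linarith [hs'.1]
      have hs1 : s < 1 := by linarith [hs'.2]
      rw [(hasDerivAt_capProfile hc (abs_lt.2 ⟨by linarith, hs1⟩)).deriv]
      have e1 : capFlux c μ s ≤ capFlux c μ (b / 2) := hflux hmid ⟨hs0.le, hs'.2⟩ hs'.1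
      -- The derivative is negative and the weight is at most `1`, so multiplying by the weight can
      -- only increase it.
      have e2 : capProfileDeriv c μ s ≤ capFlux c μ s := by
        have e3 : (s * (1 - s)) ^ c ≤ 1 :=
          Real.rpow_le_one (mul_pos hs0 (sub_pos.2 hs1)).le (by nlinarith) (by linarith)
        have e4 := capProfileDeriv_neg hc hμ hs0 hs1
          fun t ht => hG' t ⟨ht.1, ht.2.trans hs'.2⟩
        rw [capFlux]
        nlinarith
      exact e2.trans e1
  have h4 := hG b (right_mem_Icc.2 hb0.le)
  have h5 : μ * m * b ^ 2 = 8 := by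
    rw [hμdef]
    field_simp
  have h6 : capFlux c μ (b / 2) * (b - b / 2) ≤ -(μ * m * g) * (b / 2 - b / 4) * (b / 2) := by
    have : b - b / 2 = b / 2 := by ring
    rw [this]
    exact mul_le_mul_of_nonneg_right (by linarith) (by linarith)
  have h7 : -(μ * m * g) * (b / 2 - b / 4) * (b / 2) = -g := by
    linear_combination (-g / 8) * h5
  linarith

/-- Sturm comparison: while both profiles are positive, the one with the smaller eigenvalue cannot
vanish first. -/
theorem capProfile_ne_zero_of_lt (hc : 1 / 2 ≤ c) {ν b : ℝ} (hμ : 0 < μ) (hμν : μ < ν)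
    (hb0 : 0 < b) (hb : b < 1) (h₁ : ∀ s ∈ Ico 0 b, 0 < capProfile c μ s)
    (h₂ : ∀ s ∈ Ico 0 b, 0 < capProfile c ν s) (hνb : 0 ≤ capProfile c ν b) :
    capProfile c μ b ≠ 0 := by
  intro hz
  -- The weighted Wronskian: it vanishes at `0` and has derivative `(ν - μ) (s (1 - s)) ^ (c - 1)
  -- G_μ G_ν > 0`. If `G_μ` vanished at `b`, its value there would be `G_ν` times a negative flux,
  -- hence not positive.
  set W : ℝ → ℝ := fun s => capProfile c ν s * capFlux c μ s - capProfile c μ s * capFlux c ν s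
    with hW
  have hstrict : StrictMonoOn W (Icc 0 b) := by
    refine strictMonoOn_of_deriv_pos (convex_Icc 0 b)
      (ContinuousOn.mono (((continuousOn_capProfile hc).mul (continuousOn_capFlux hc)).sub
        ((continuousOn_capProfile hc).mul (continuousOn_capFlux hc))) (Icc_subset_Ico_right hb))
      fun s hs => ?_
    rw [interior_Icc] at hs
    have hs1 : s ∈ Ioo (0 : ℝ) 1 := ⟨hs.1, hs.2.trans hb⟩
    have hs2 : |s| < 1 := abs_lt.2 ⟨by linarith [hs.1], hs1.2⟩
    have hd := ((hasDerivAt_capProfile (μ := ν) hc hs2).mul (hasDerivAt_capFlux (μ := μ) hc hs1)).sub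
      ((hasDerivAt_capProfile (μ := μ) hc hs2).mul (hasDerivAt_capFlux (μ := ν) hc hs1))
    have hd' : HasDerivAt W ((ν - μ) * (s * (1 - s)) ^ (c - 1) * capProfile c μ s *
        capProfile c ν s) s := by
      refine hd.congr_deriv ?_
      simp only [capFlux]
      ring
    rw [hd'.deriv]
    have e1 := h₁ s ⟨hs.1.le, hs.2⟩
    have e2 := h₂ s ⟨hs.1.le, hs.2⟩
    have e3 : 0 < s * (1 - s) := mul_pos hs1.1 (sub_pos.2 hs1.2)
    have e4 : 0 < ν - μ := sub_pos.2 hμν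
    positivity
  have h := hstrict (left_mem_Icc.2 hb0.le) (right_mem_Icc.2 hb0.le) hb0
  simp only [hW, capFlux_zero hc, hz, mul_zero, zero_mul, sub_zero] at h
  have hneg := capFlux_neg hc hμ hb0 hb fun s hs => by
    rcases hs.2.lt_or_eq with h' | rfl
    · exact (h₁ s ⟨hs.1, h'⟩).le
    · exact hz.ge
  nlinarith

/-- The first Dirichlet eigenvalue of the zonal problem on `[0, b]`. -/
theorem exists_first_eigenvalue (hc : 1 / 2 ≤ c) {b : ℝ} (hb0 : 0 < b) (hb : b < 1) :
    ∃ μ₀, 0 < μ₀ ∧ capProfile c μ₀ b = 0 ∧ (∀ s ∈ Ico 0 b, 0 < capProfile c μ₀ s) ∧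
      ∀ μ, 0 ≤ μ → μ < μ₀ → ∀ s ∈ Icc 0 b, 0 < capProfile c μ s := by
  obtain ⟨M, hM0, s₁, hs₁, hM⟩ := exists_capProfile_nonpos hc hb0 hb
  have hcont : ContinuousOn (fun p : ℝ × ℝ => capProfile c p.1 p.2) (Icc 0 M ×ˢ Icc 0 b) :=
    (continuousOn_capProfile_prod (M := M) hc hb0.le hb).mono
      (prod_mono (Icc_subset_Icc_left (by linarith)) (Icc_subset_Icc_left (by linarith)))
  have hK : IsCompact (Icc 0 M ×ˢ Icc 0 b) := isCompact_Icc.prod isCompact_Icc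
  -- The pairs `(μ, s)` at which the profile is nonpositive form a compact set; `μ₀` is its least
  -- first coordinate.
  have hE : IsCompact ((Icc 0 M ×ˢ Icc 0 b) ∩ {p : ℝ × ℝ | capProfile c p.1 p.2 ≤ 0}) :=
    hK.of_isClosed_subset (hcont.preimage_isClosed_of_isClosed hK.isClosed isClosed_Iic)
      inter_subset_left
  obtain ⟨⟨μ₀, s₀⟩, ⟨⟨hμ₀, hs₀⟩, hle⟩, hmin⟩ := hE.exists_isMinOn
    ⟨(M, s₁), ⟨⟨hM0.le, le_rfl⟩, hs₁⟩, hM⟩ continuous_fst.continuousOn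
  simp only at hμ₀ hs₀
  simp only [mem_ofPred_eq] at hle
  have hlt : ∀ μ, 0 ≤ μ → μ < μ₀ → ∀ s ∈ Icc 0 b, 0 < capProfile c μ s := by
    intro μ hμ hμμ₀ s hs
    by_contra! hn
    have : μ₀ ≤ μ := hmin (show (μ, s) ∈ _ from ⟨⟨⟨hμ, (hμμ₀.trans_le hμ₀.2).le⟩, hs⟩, hn⟩)
    linarith
  have hpos : 0 < μ₀ := by
    refine lt_of_le_of_ne hμ₀.1 fun h => ?_
    rw [← h, capProfile_eigenvalue_zero] at hle
    linarith
  -- Let `μ` increase to `μ₀`: the limit of positive profiles is nonnegative. Strict monotonicity in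
  -- `s` then forces the zero to lie at `b`.
  have hnonneg : ∀ s ∈ Icc 0 b, 0 ≤ capProfile c μ₀ s := by
    intro s hs
    have hc1 : ContinuousWithinAt (fun μ => capProfile c μ s) (Icc 0 M) μ₀ :=
      (hcont (μ₀, s) ⟨hμ₀, hs⟩).comp (f := fun μ => (μ, s)) (by fun_prop) fun μ hμ => ⟨hμ, hs⟩
    have hc2 : Tendsto (fun μ => capProfile c μ s) (𝓝[<] μ₀) (𝓝 (capProfile c μ₀ s)) :=
      hc1.mono_left (nhdsWithin_le_of_mem (mem_of_superset (Ioo_mem_nhdsLT hpos)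
        fun μ hμ => ⟨hμ.1.le, hμ.2.le.trans hμ₀.2⟩))
    refine ge_of_tendsto hc2 ?_
    filter_upwards [Ioo_mem_nhdsLT hpos] with μ hμ
    exact (hlt μ hμ.1.le hμ.2 s hs).le
  have hanti := strictAntiOn_capProfile hc hpos hb hnonneg
  have hbmem := right_mem_Icc.2 hb0.le
  have hzero : capProfile c μ₀ b = 0 :=
    le_antisymm ((hanti.antitoneOn hs₀ hbmem hs₀.2).trans hle) (hnonneg b hbmem)
  refine ⟨μ₀, hpos, hzero, fun s hs => ?_, hlt⟩
  rw [← hzero]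
  exact hanti ⟨hs.1, hs.2.le⟩ hbmem hs.2

/-- Comparison of the first eigenvalue with the one of the half-sphere. -/
theorem first_eigenvalue_compare (hc : 1 / 2 ≤ c) {b μ₀ : ℝ} (hb0 : 0 < b) (hb : b < 1)
    (hμ₀ : 0 < μ₀) (hzero : capProfile c μ₀ b = 0) (hpos : ∀ s ∈ Ico 0 b, 0 < capProfile c μ₀ s)
    (hlt : ∀ μ, 0 ≤ μ → μ < μ₀ → ∀ s ∈ Icc 0 b, 0 < capProfile c μ s) :
    (b < 1 / 2 → 2 * c < μ₀) ∧ (b = 1 / 2 → μ₀ = 2 * c) ∧ (1 / 2 < b → μ₀ < 2 * c) := by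
  have hge : b ≤ 1 / 2 → 2 * c ≤ μ₀ := by
    intro hb2
    by_contra! h
    refine capProfile_ne_zero_of_lt hc hμ₀ h hb0 hb hpos (fun s hs => ?_) ?_ hzero
    · rw [capProfile_two_mul hc]
      linarith [hs.2]
    · rw [capProfile_two_mul hc]
      linarith
  have hle : 1 / 2 ≤ b → μ₀ ≤ 2 * c := by
    intro hb2
    by_contra! h
    have := hlt (2 * c) (by linarith) h b (right_mem_Icc.2 hb0.le)
    rw [capProfile_two_mul hc] at this
    linarith
  have hne : μ₀ = 2 * c → b = 1 / 2 := by
    intro h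
    rw [h, capProfile_two_mul hc] at hzero
    linarith
  refine ⟨fun h => lt_of_le_of_ne (hge h.le) fun e => ?_, fun h => le_antisymm (hle h.ge) (hge h.le),
    fun h => lt_of_le_of_ne (hle h.le) fun e => ?_⟩
  · linarith [hne e.symm]
  · linarith [hne e]

end capFlux

/-! ### Second-order conditions at a local maximum -/

section SecondDerivative

variable {E : Type*} [NormedAddCommGroup E] [NormedSpace ℝ E] {f : E → ℝ} {x : E}

theorem ContDiffAt.eventually_hasDerivAt_line (hf : ContDiffAt ℝ 2 f x) (v : E) :
    ∀ᶠ t : ℝ in 𝓝 0, HasDerivAt (fun t : ℝ => f (x + t • v)) (fderiv ℝ f (x + t • v) v) t := by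
  have hev : ∀ᶠ y in 𝓝 x, DifferentiableAt ℝ f y :=
    (hf.eventually (by simp)).mono fun y hy => hy.differentiableAt (by simp)
  have hline : Tendsto (fun t : ℝ => x + t • v) (𝓝 0) (𝓝 x) := by
    have : Continuous fun t : ℝ => x + t • v := by fun_prop
    simpa using this.tendsto 0
  filter_upwards [hline.eventually hev] with t ht
  have hl : HasDerivAt (fun t : ℝ => x + t • v) v t := by
    simpa using ((hasDerivAt_id t).smul_const v).const_add x
  exact ht.hasFDerivAt.comp_hasDerivAt t hl

theorem ContDiffAt.hasDerivAt_deriv_line (hf : ContDiffAt ℝ 2 f x) (v : E) :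
    HasDerivAt (deriv fun t : ℝ => f (x + t • v)) (iteratedFDeriv ℝ 2 f x ![v, v]) 0 := by
  have h1 : deriv (fun t : ℝ => f (x + t • v)) =ᶠ[𝓝 0] fun t => fderiv ℝ f (x + t • v) v :=
    (hf.eventually_hasDerivAt_line v).mono fun t ht => ht.deriv
  have hd : DifferentiableAt ℝ (fderiv ℝ f) x :=
    (hf.fderiv_right (m := 1) (by norm_num)).differentiableAt (by simp)
  have hl : HasDerivAt (fun t : ℝ => x + t • v) v 0 := by
    simpa using ((hasDerivAt_id (0 : ℝ)).smul_const v).const_add x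
  have h2 : HasDerivAt (fun t : ℝ => fderiv ℝ f (x + t • v)) (fderiv ℝ (fderiv ℝ f) x v) 0 :=
    HasFDerivAt.comp_hasDerivAt (f := fun t : ℝ => x + t • v) 0
      (by simpa using hd.hasFDerivAt) hl
  have h3 := h2.clm_apply (hasDerivAt_const (0 : ℝ) v)
  refine (h3.congr_of_eventuallyEq h1).congr_deriv ?_
  simp [iteratedFDeriv_two_apply]

/-- Were the second derivative positive, the point would also be a local minimum, so `g` would be
locally constant with second derivative zero. -/
theorem IsLocalMax.hasDerivAt_deriv_nonpos {g : ℝ → ℝ} {t a : ℝ} (hmax : IsLocalMax g t)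
    (hcont : ContinuousAt g t) (hg : HasDerivAt (deriv g) a t) : a ≤ 0 := by
  by_contra! ha
  have hmin := isLocalMin_of_deriv_deriv_pos (by rwa [hg.deriv]) hmax.deriv_eq_zero hcont
  have hconst : g =ᶠ[𝓝 t] fun _ => g t := by
    filter_upwards [hmax, hmin] with s h1 h2 using le_antisymm h1 h2
  have h := hconst.deriv.deriv_eq
  rw [hg.deriv] at h
  simp at h
  exact ha.ne' h

theorem IsLocalMax.iteratedFDeriv_two_nonpos (hmax : IsLocalMax f x) (hf : ContDiffAt ℝ 2 f x)
    (v : E) : iteratedFDeriv ℝ 2 f x ![v, v] ≤ 0 := by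
  have hline : ContinuousAt (fun t : ℝ => x + t • v) 0 := by fun_prop
  refine IsLocalMax.hasDerivAt_deriv_nonpos (g := fun t : ℝ => f (x + t • v)) ?_ ?_
    (hf.hasDerivAt_deriv_line v)
  · have hmax' : IsLocalMax f (x + (0 : ℝ) • v) := by simpa using hmax
    exact IsLocalMax.comp_continuous (g := fun t : ℝ => x + t • v) hmax' hline
  · exact ContinuousAt.comp (by simpa using hf.continuousAt) hline

end SecondDerivative

theorem IsLocalMax.laplacian_nonpos {E : Type*} [NormedAddCommGroup E] [InnerProductSpace ℝ E]
    [FiniteDimensional ℝ E] {f : E → ℝ} {x : E} (hmax : IsLocalMax f x)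
    (hf : ContDiffAt ℝ 2 f x) : Laplacian.laplacian f x ≤ 0 := by
  rw [InnerProductSpace.laplacian_eq_iteratedFDeriv_stdOrthonormalBasis]
  exact Finset.sum_nonpos fun i _ => hmax.iteratedFDeriv_two_nonpos hf _

/-! ### Zonal functions and the Laplace-Beltrami operator -/

/-- The function on the sphere with profile `G` in the variable `(1 - x₁) / 2`. -/
noncomputable def zonal {N : ℕ} [NeZero N] (G : ℝ → ℝ)
    (p : Metric.sphere (0 : EuclideanSpace ℝ (Fin N)) 1) : ℝ :=
  G ((1 - (p : EuclideanSpace ℝ (Fin N)) 0) / 2)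

section zonal

variable {N : ℕ}

theorem radialExtension_of_ne_zero (Θ : Metric.sphere (0 : EuclideanSpace ℝ (Fin N)) 1 → ℝ)
    {x : EuclideanSpace ℝ (Fin N)} (hx : x ≠ 0) :
    radialExtension Θ x = Θ ⟨‖x‖⁻¹ • x, inv_norm_smul_mem_unitSphere hx⟩ := by
  rw [radialExtension, dif_pos hx]

theorem radialExtension_coe (Θ : Metric.sphere (0 : EuclideanSpace ℝ (Fin N)) 1 → ℝ)
    (p : Metric.sphere (0 : EuclideanSpace ℝ (Fin N)) 1) : radialExtension Θ p = Θ p := by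
  have hp : ‖(p : EuclideanSpace ℝ (Fin N))‖ = 1 := mem_sphere_zero_iff_norm.1 p.2
  have h0 : (p : EuclideanSpace ℝ (Fin N)) ≠ 0 := norm_ne_zero_iff.1 (by rw [hp]; exact one_ne_zero)
  rw [radialExtension_of_ne_zero Θ h0]
  congr 1
  ext1
  simp [hp]

theorem radialExtension_neg (Θ : Metric.sphere (0 : EuclideanSpace ℝ (Fin N)) 1 → ℝ) :
    radialExtension (-Θ) = -radialExtension Θ := by
  ext x
  by_cases hx : x = 0
  · simp [radialExtension, hx]
  · simp [radialExtension, hx]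

/-- The projection `y ↦ y / ‖y‖` is continuous near `p` and fixes `p`, so a maximum on the sphere
becomes one in the ambient space, where the Euclidean Laplacian is available. -/
theorem isLocalMax_radialExtension_sub_smul
    {Θ Φ : Metric.sphere (0 : EuclideanSpace ℝ (Fin N)) 1 → ℝ} {m : ℝ}
    {p : Metric.sphere (0 : EuclideanSpace ℝ (Fin N)) 1}
    (hmax : IsLocalMax (fun q => Θ q - m * Φ q) p) :
    IsLocalMax (radialExtension Θ - m • radialExtension Φ) (p : EuclideanSpace ℝ (Fin N)) := by
  have hp : ‖(p : EuclideanSpace ℝ (Fin N))‖ = 1 := mem_sphere_zero_iff_norm.1 p.2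
  have h0 : (p : EuclideanSpace ℝ (Fin N)) ≠ 0 := norm_ne_zero_iff.1 (by rw [hp]; exact one_ne_zero)
  have hcont : ContinuousAt (fun y : EuclideanSpace ℝ (Fin N) => ‖y‖⁻¹ • y)
      (p : EuclideanSpace ℝ (Fin N)) :=
    (continuous_norm.continuousAt.inv₀ (by simp)).smul continuousAt_id
  have hev : ∀ᶠ q in 𝓝 p, Θ q - m * Φ q ≤ Θ p - m * Φ p := hmax
  rw [nhds_subtype_eq_comap, eventually_comap] at hev
  have hev' : ∀ᶠ y : EuclideanSpace ℝ (Fin N) in 𝓝 (p : EuclideanSpace ℝ (Fin N)),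
      ∀ q : Metric.sphere (0 : EuclideanSpace ℝ (Fin N)) 1,
        (q : EuclideanSpace ℝ (Fin N)) = ‖y‖⁻¹ • y → Θ q - m * Φ q ≤ Θ p - m * Φ p :=
    hcont.tendsto.eventually (by rwa [hp, inv_one, one_smul])
  filter_upwards [hev', isOpen_ne.mem_nhds h0] with y hy hy0
  simp only [Pi.sub_apply, Pi.smul_apply, smul_eq_mul, radialExtension_coe]
  rw [radialExtension_of_ne_zero Θ hy0, radialExtension_of_ne_zero Φ hy0]
  exact hy _ rfl

variable [NeZero N]

theorem radialExtension_zonal_eventuallyEq (G : ℝ → ℝ) {x : EuclideanSpace ℝ (Fin N)}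
    (hx : x ≠ 0) :
    radialExtension (zonal G) =ᶠ[𝓝 x] fun y => G ((1 - ‖y‖⁻¹ * y 0) / 2) := by
  filter_upwards [isOpen_ne.mem_nhds hx] with y hy
  rw [radialExtension_of_ne_zero _ hy, zonal]
  simp

theorem contDiffAt_radialExtension_zonal {G : ℝ → ℝ}
    (p : Metric.sphere (0 : EuclideanSpace ℝ (Fin N)) 1)
    (hG : ContDiffAt ℝ 2 G ((1 - (p : EuclideanSpace ℝ (Fin N)) 0) / 2)) :
    ContDiffAt ℝ 2 (radialExtension (zonal G)) (p : EuclideanSpace ℝ (Fin N)) := by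
  have hp : ‖(p : EuclideanSpace ℝ (Fin N))‖ = 1 := mem_sphere_zero_iff_norm.1 p.2
  have h0 : (p : EuclideanSpace ℝ (Fin N)) ≠ 0 := norm_ne_zero_iff.1 (by rw [hp]; exact one_ne_zero)
  refine ContDiffAt.congr_of_eventuallyEq ?_ (radialExtension_zonal_eventuallyEq G h0)
  have hproj : ContDiff ℝ 2 fun y : EuclideanSpace ℝ (Fin N) => y 0 :=
    (EuclideanSpace.proj (𝕜 := ℝ) (0 : Fin N)).contDiff
  have hin : ContDiffAt ℝ 2 (fun y : EuclideanSpace ℝ (Fin N) => (1 - ‖y‖⁻¹ * y 0) / 2)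
      (p : EuclideanSpace ℝ (Fin N)) :=
    (contDiffAt_const.sub (((contDiffAt_norm ℝ h0).inv (by simp)).mul
      hproj.contDiffAt)).div_const 2
  refine ContDiffAt.comp (p : EuclideanSpace ℝ (Fin N)) ?_ hin
  simpa [hp] using hG

theorem hasDerivAt_sqrt_quadratic {a t : ℝ} (ht : 1 + 2 * t * a + t ^ 2 ≠ 0) :
    HasDerivAt (fun t : ℝ => √(1 + 2 * t * a + t ^ 2)) ((a + t) / √(1 + 2 * t * a + t ^ 2)) t := by
  have h : HasDerivAt (fun t : ℝ => 1 + 2 * t * a + t ^ 2) (2 * a + 2 * t) t := by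
    have h1 := ((((hasDerivAt_id t).const_mul 2).mul_const a).const_add 1).add (hasDerivAt_pow 2 t)
    refine h1.congr_deriv ?_
    simp
  refine (h.sqrt ht).congr_deriv ?_
  rw [← mul_add, mul_div_mul_left _ _ two_ne_zero]

/-- The second derivative at `t = 0` of a function of the zonal variable along the line
`x + t e`, where `x` and `e` are unit vectors, `a` is the scalar product of `x` and `e`, and
`z` and `d` are the first coordinates of `x` and `e`. -/
theorem hasDerivAt_deriv_zonal_line {G G₁ : ℝ → ℝ} {G₂ a z d : ℝ}
    (hG : ∀ᶠ s in 𝓝 ((1 - z) / 2), HasDerivAt G (G₁ s) s)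
    (hG₁ : HasDerivAt G₁ G₂ ((1 - z) / 2)) :
    HasDerivAt (deriv fun t : ℝ => G ((1 - (√(1 + 2 * t * a + t ^ 2))⁻¹ * (z + t * d)) / 2))
      (G₂ * ((d - z * a) ^ 2 / 4) + G₁ ((1 - z) / 2) * (a * d + z / 2 - 3 / 2 * z * a ^ 2)) 0 := by
  set ρ : ℝ → ℝ := fun t => √(1 + 2 * t * a + t ^ 2) with hρ
  set u : ℝ → ℝ := fun t => (1 - (ρ t)⁻¹ * (z + t * d)) / 2 with hu
  set u₁ : ℝ → ℝ := fun t => -((ρ t)⁻¹ * d - (a + t) * (z + t * d) * ((ρ t)⁻¹) ^ 3) / 2 with hu₁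
  have hρ0 : ρ 0 = 1 := by simp [hρ]
  have hlin : ∀ t : ℝ, HasDerivAt (fun t : ℝ => z + t * d) d t := fun t => by
    simpa using ((hasDerivAt_id t).mul_const d).const_add z
  have hpos : ∀ᶠ t : ℝ in 𝓝 0, 0 < 1 + 2 * t * a + t ^ 2 :=
    (isOpen_lt (by fun_prop) (by fun_prop)).mem_nhds (by simp)
  have hinv : ∀ t : ℝ, 0 < 1 + 2 * t * a + t ^ 2 →
      HasDerivAt (fun t => (ρ t)⁻¹) (-((a + t) * ((ρ t)⁻¹) ^ 3)) t := fun t ht => by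
    have hne : ρ t ≠ 0 := (Real.sqrt_pos.2 ht).ne'
    refine ((hasDerivAt_sqrt_quadratic ht.ne').inv hne).congr_deriv ?_
    change -((a + t) / ρ t) / ρ t ^ 2 = _
    field_simp
  have hud : ∀ t : ℝ, 0 < 1 + 2 * t * a + t ^ 2 → HasDerivAt u (u₁ t) t := fun t ht => by
    refine ((((hinv t ht).mul (hlin t)).const_sub 1).div_const 2).congr_deriv ?_
    simp only [hu₁]
    ring
  have hu0 : u 0 = (1 - z) / 2 := by simp [hu, hρ0]
  have h0 : (0 : ℝ) < 1 + 2 * 0 * a + 0 ^ 2 := by simp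
  have hucont : ContinuousAt u 0 := (hud 0 h0).continuousAt
  have hev : deriv (fun t => G (u t)) =ᶠ[𝓝 0] fun t => G₁ (u t) * u₁ t := by
    have h1 : ∀ᶠ t in 𝓝 0, HasDerivAt G (G₁ (u t)) (u t) :=
      hucont.eventually (by rw [hu0]; exact hG)
    filter_upwards [h1, hpos] with t ht1 ht2
    exact (ht1.comp t (hud t ht2)).deriv
  have hu₁d : HasDerivAt u₁ (a * d + z / 2 - 3 / 2 * z * a ^ 2) 0 := by
    have hadd : HasDerivAt (fun t : ℝ => a + t) 1 0 := by
      simpa using (hasDerivAt_id (0 : ℝ)).const_add a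
    have h1 := (((hinv 0 h0).mul_const d).sub
      ((hadd.mul (hlin 0)).mul ((hinv 0 h0).pow 3))).neg.div_const 2
    refine h1.congr_deriv ?_
    simp [hρ0]
    ring
  have hGu : HasDerivAt (fun t => G₁ (u t)) (G₂ * u₁ 0) 0 :=
    HasDerivAt.comp 0 (by rw [hu0]; exact hG₁) (hud 0 h0)
  refine ((hGu.mul hu₁d).congr_of_eventuallyEq hev).congr_deriv ?_
  simp only [hu₁, hu0, hρ0]
  ring

/-- The Laplace-Beltrami operator in the zonal variable. -/
theorem sphereLaplacian_zonal {G G₁ : ℝ → ℝ} {G₂ : ℝ}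
    (p : Metric.sphere (0 : EuclideanSpace ℝ (Fin N)) 1) {s : ℝ}
    (hs : s = (1 - (p : EuclideanSpace ℝ (Fin N)) 0) / 2)
    (hG : ∀ᶠ s in 𝓝 s, HasDerivAt G (G₁ s) s) (hG₁ : HasDerivAt G₁ G₂ s)
    (hC : ContDiffAt ℝ 2 G s) :
    sphereLaplacian (zonal G) p =
      s * (1 - s) * G₂ + ((N : ℝ) - 1) / 2 * (1 - 2 * s) * G₁ s := by
  have hp : ‖(p : EuclideanSpace ℝ (Fin N))‖ = 1 := mem_sphere_zero_iff_norm.1 p.2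
  have h0 : (p : EuclideanSpace ℝ (Fin N)) ≠ 0 := norm_ne_zero_iff.1 (by rw [hp]; exact one_ne_zero)
  set x : EuclideanSpace ℝ (Fin N) := (p : EuclideanSpace ℝ (Fin N)) with hx
  set z := x 0 with hz
  have hsum : ∑ i, x i ^ 2 = 1 := by
    rw [← EuclideanSpace.real_norm_sq_eq, hp, one_pow]
  have hterm : ∀ i : Fin N, iteratedFDeriv ℝ 2 (radialExtension (zonal G)) x
      ![EuclideanSpace.basisFun (Fin N) ℝ i, EuclideanSpace.basisFun (Fin N) ℝ i] =
      G₂ * (((if i = 0 then 1 else 0) - z * x i) ^ 2 / 4) +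
        G₁ s * (x i * (if i = 0 then 1 else 0) + z / 2 - 3 / 2 * z * x i ^ 2) := by
    intro i
    rw [((radialExtension_zonal_eventuallyEq G h0).iteratedFDeriv ℝ 2).eq_of_nhds]
    have hC' : ContDiffAt ℝ 2 (fun y : EuclideanSpace ℝ (Fin N) => G ((1 - ‖y‖⁻¹ * y 0) / 2)) x :=
      (contDiffAt_radialExtension_zonal p (by rwa [← hx, ← hz, ← hs])).congr_of_eventuallyEq
        (radialExtension_zonal_eventuallyEq G h0).symm
    have h1 := hC'.hasDerivAt_deriv_line (EuclideanSpace.basisFun (Fin N) ℝ i)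
    rw [hs] at hG hG₁
    have h2 := hasDerivAt_deriv_zonal_line (a := x i) (d := if i = 0 then 1 else 0) hG hG₁
    rw [← hs] at h2
    have hline : (fun t : ℝ => G ((1 - ‖x + t • EuclideanSpace.basisFun (Fin N) ℝ i‖⁻¹ *
        (x + t • EuclideanSpace.basisFun (Fin N) ℝ i) 0) / 2)) = fun t : ℝ =>
        G ((1 - (√(1 + 2 * t * x i + t ^ 2))⁻¹ * (z + t * if i = 0 then 1 else 0)) / 2) := by
      ext t
      have hsq : 1 + 2 * t * x i + t ^ 2 = ‖x + t • EuclideanSpace.basisFun (Fin N) ℝ i‖ ^ 2 := by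
        rw [norm_add_sq_real, hp, inner_smul_right, norm_smul, OrthonormalBasis.norm_eq_one,
          real_inner_comm, EuclideanSpace.basisFun_inner, mul_one, Real.norm_eq_abs, sq_abs]
        ring
      rw [hsq, Real.sqrt_sq (norm_nonneg _)]
      simp [hz, eq_comm]
    rw [hline] at h1
    exact h1.unique h2
  rw [sphereLaplacian, InnerProductSpace.laplacian_eq_iteratedFDeriv_orthonormalBasis _
    (EuclideanSpace.basisFun (Fin N) ℝ)]
  have hsplit : ∀ i : Fin N, G₂ * (((if i = 0 then 1 else 0) - z * x i) ^ 2 / 4) +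
        G₁ s * (x i * (if i = 0 then 1 else 0) + z / 2 - 3 / 2 * z * x i ^ 2) =
      (if i = 0 then G₂ / 4 + (G₁ s - G₂ * z / 2) * x i else 0) +
        (G₂ * z ^ 2 / 4 - 3 / 2 * G₁ s * z) * x i ^ 2 + G₁ s * z / 2 := by
    -- Separating the Kronecker delta makes the trace computable from `∑ x i ^ 2 = 1`.
    intro i
    split_ifs <;> ring
  refine (Finset.sum_congr rfl fun i _ => (hterm i).trans (hsplit i)).trans ?_
  simp only [Finset.sum_add_distrib, ← Finset.mul_sum, hsum, Finset.sum_ite_eq',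
    Finset.mem_univ, if_true, Finset.sum_const, Finset.card_univ, Fintype.card_fin, nsmul_eq_mul]
  rw [← hz, hs]
  ring

end zonal

/-! ### Geometry of the cap, barrier and zonal solution -/

section Cap

variable {N : ℕ} [NeZero N]

theorem cos_angle_single (x : EuclideanSpace ℝ (Fin N)) :
    Real.cos (InnerProductGeometry.angle (EuclideanSpace.single (0 : Fin N) (1 : ℝ)) x) =
      x 0 / ‖x‖ := by
  rw [InnerProductGeometry.cos_angle, EuclideanSpace.inner_single_left]
  simp

theorem cos_le_of_mem_sphericalCap {β : ℝ} (hβ : β ∈ Ioo 0 Real.pi)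
    {p : Metric.sphere (0 : EuclideanSpace ℝ (Fin N)) 1} (hp : p ∈ sphericalCap N β) :
    Real.cos β ≤ (p : EuclideanSpace ℝ (Fin N)) 0 := by
  have hsub : sphericalCone N β ⊆ {x | Real.cos β * ‖x‖ ≤ x 0} := by
    rintro x ⟨hx0, -, hx⟩
    have h := Real.cos_lt_cos_of_nonneg_of_le_pi (InnerProductGeometry.angle_nonneg _ _) hβ.2.le hx
    rw [cos_angle_single, lt_div_iff₀ hx0] at h
    exact h.le
  have hclosed : IsClosed {x : EuclideanSpace ℝ (Fin N) | Real.cos β * ‖x‖ ≤ x 0} :=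
    isClosed_le (by fun_prop) (by fun_prop)
  have h : Real.cos β * ‖(p : EuclideanSpace ℝ (Fin N))‖ ≤ (p : EuclideanSpace ℝ (Fin N)) 0 :=
    closure_minimal hsub hclosed hp
  rwa [mem_sphere_zero_iff_norm.1 p.2, mul_one] at h

theorem mem_sphericalCap_of_cos_lt {β : ℝ} (hβ : β ∈ Ioo 0 Real.pi)
    {p : Metric.sphere (0 : EuclideanSpace ℝ (Fin N)) 1}
    (hp : Real.cos β < (p : EuclideanSpace ℝ (Fin N)) 0) : p ∈ sphericalCap N β := by
  have hn : ‖(p : EuclideanSpace ℝ (Fin N))‖ = 1 := mem_sphere_zero_iff_norm.1 p.2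
  have hangle : InnerProductGeometry.angle (EuclideanSpace.single (0 : Fin N) (1 : ℝ))
      (p : EuclideanSpace ℝ (Fin N)) < β := by
    by_contra! h
    have := Real.cos_le_cos_of_nonneg_of_le_pi hβ.1.le (InnerProductGeometry.angle_le_pi _ _) h
    rw [cos_angle_single, hn, div_one] at this
    linarith
  -- The cone excludes the unit sphere, so `p` is approached along its own ray from inside.
  have hlim : Tendsto (fun t : ℝ => t • (p : EuclideanSpace ℝ (Fin N))) (𝓝[<] 1)
      (𝓝 (p : EuclideanSpace ℝ (Fin N))) := by
    have hcont : Continuous fun t : ℝ => t • (p : EuclideanSpace ℝ (Fin N)) := by fun_prop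
    simpa using (hcont.tendsto 1).mono_left nhdsWithin_le_nhds
  refine mem_closure_of_tendsto hlim ?_
  filter_upwards [Ioo_mem_nhdsLT (zero_lt_one' ℝ)] with t ht
  have ht' : ‖t • (p : EuclideanSpace ℝ (Fin N))‖ = t := by
    rw [norm_smul, hn, mul_one, Real.norm_of_nonneg ht.1.le]
  refine ⟨by rw [ht']; exact ht.1, by rw [ht']; exact ht.2, ?_⟩
  rwa [InnerProductGeometry.angle_smul_right_of_pos _ _ ht.1]

theorem isClosed_sphericalCap (β : ℝ) : IsClosed (sphericalCap N β) :=
  isClosed_closure.preimage continuous_subtype_val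

theorem coord_eq_cos_of_mem_frontier {β : ℝ} (hβ : β ∈ Ioo 0 Real.pi)
    {p : Metric.sphere (0 : EuclideanSpace ℝ (Fin N)) 1} (hp : p ∈ frontier (sphericalCap N β)) :
    (p : EuclideanSpace ℝ (Fin N)) 0 = Real.cos β := by
  rw [(isClosed_sphericalCap β).frontier_eq] at hp
  refine le_antisymm (not_lt.1 fun h => hp.2 ?_) (cos_le_of_mem_sphericalCap hβ hp.1)
  have hopen : IsOpen {q : Metric.sphere (0 : EuclideanSpace ℝ (Fin N)) 1 |
      Real.cos β < (q : EuclideanSpace ℝ (Fin N)) 0} := isOpen_lt (by fun_prop) (by fun_prop)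
  exact interior_maximal (fun q hq => mem_sphericalCap_of_cos_lt hβ hq) hopen h

theorem coord_le_one (p : Metric.sphere (0 : EuclideanSpace ℝ (Fin N)) 1) :
    (p : EuclideanSpace ℝ (Fin N)) 0 ≤ 1 := by
  have h := PiLp.norm_apply_le (p : EuclideanSpace ℝ (Fin N)) 0
  rw [mem_sphere_zero_iff_norm.1 p.2] at h
  exact (le_abs_self _).trans h

/-- The zonal variable of the boundary of the cap of angle `β`. -/
noncomputable def capHeight (β : ℝ) : ℝ := (1 - Real.cos β) / 2

theorem capHeight_pos {β : ℝ} (hβ : β ∈ Ioo 0 Real.pi) : 0 < capHeight β := by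
  have h := Real.cos_lt_cos_of_nonneg_of_le_pi le_rfl hβ.2.le hβ.1
  rw [Real.cos_zero] at h
  rw [capHeight]
  linarith

theorem capHeight_lt_one {β : ℝ} (hβ : β ∈ Ioo 0 Real.pi) : capHeight β < 1 := by
  have h := Real.cos_lt_cos_of_nonneg_of_le_pi hβ.1.le le_rfl hβ.2
  rw [Real.cos_pi] at h
  rw [capHeight]
  linarith

theorem zonalVariable_mem_Icc {β : ℝ} (hβ : β ∈ Ioo 0 Real.pi)
    {p : Metric.sphere (0 : EuclideanSpace ℝ (Fin N)) 1} (hp : p ∈ sphericalCap N β) :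
    (1 - (p : EuclideanSpace ℝ (Fin N)) 0) / 2 ∈ Icc 0 (capHeight β) := by
  have h1 := coord_le_one p
  have h2 := cos_le_of_mem_sphericalCap hβ hp
  rw [capHeight]
  constructor <;> linarith

theorem zonalVariable_abs_lt_one {β : ℝ} (hβ : β ∈ Ioo 0 Real.pi)
    {p : Metric.sphere (0 : EuclideanSpace ℝ (Fin N)) 1} (hp : p ∈ sphericalCap N β) :
    |(1 - (p : EuclideanSpace ℝ (Fin N)) 0) / 2| < 1 := by
  have h := zonalVariable_mem_Icc hβ hp
  exact abs_lt.2 ⟨by linarith [h.1], h.2.trans_lt (capHeight_lt_one hβ)⟩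

variable {c μ β : ℝ}

theorem sphereLaplacian_zonal_capProfile (hc : 1 / 2 ≤ c) (hcN : c = ((N : ℝ) - 1) / 2)
    (hβ : β ∈ Ioo 0 Real.pi) {p : Metric.sphere (0 : EuclideanSpace ℝ (Fin N)) 1}
    (hp : p ∈ sphericalCap N β) :
    sphereLaplacian (zonal (capProfile c μ)) p = -(μ * zonal (capProfile c μ) p) := by
  have hs := zonalVariable_abs_lt_one hβ hp
  rw [sphereLaplacian_zonal p rfl (G₁ := capProfileDeriv c μ) _
    (hasDerivAt_capProfileDeriv hc hs) (contDiffAt_capProfile hc hs), ← hcN]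
  · have := capProfile_ode (μ := μ) hc hs
    rw [zonal]
    linarith
  · filter_upwards [(isOpen_lt continuous_abs continuous_const).mem_nhds hs] with s hs'
    exact hasDerivAt_capProfile hc hs'

theorem continuousOn_zonal_capProfile (hc : 1 / 2 ≤ c) (hβ : β ∈ Ioo 0 Real.pi) :
    ContinuousOn (zonal (capProfile c μ)) (sphericalCap N β) := by
  refine (continuousOn_capProfile hc).comp (Continuous.continuousOn (by fun_prop)) fun p hp => ?_
  have h := zonalVariable_mem_Icc hβ hp
  exact ⟨h.1, h.2.trans_lt (capHeight_lt_one hβ)⟩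

theorem IsCapDirichletSolution.neg {l : ℝ}
    {Θ : Metric.sphere (0 : EuclideanSpace ℝ (Fin N)) 1 → ℝ}
    (h : IsCapDirichletSolution N β l Θ) : IsCapDirichletSolution N β l (-Θ) where
  continuousOn := h.continuousOn.neg
  contDiffAt x hx := by
    rw [radialExtension_neg]
    exact (h.contDiffAt x hx).neg
  equation x hx := by
    have := h.equation x hx
    rw [sphereLaplacian] at this ⊢
    rw [radialExtension_neg, InnerProductSpace.laplacian_neg, Pi.neg_apply, Pi.neg_apply]
    linarith
  boundary x hx := by
    rw [Pi.neg_apply, h.boundary x hx, neg_zero]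
  nontrivial := by
    obtain ⟨x, hx, hne⟩ := h.nontrivial
    exact ⟨x, hx, neg_ne_zero.2 hne⟩

/-- A positive solution on the closed cap is a barrier for the solutions with a smaller
eigenvalue. -/
theorem IsCapDirichletSolution.false_of_barrier (hc : 1 / 2 ≤ c) (hcN : c = ((N : ℝ) - 1) / 2)
    (hβ : β ∈ Ioo 0 Real.pi) {l : ℝ} {Θ : Metric.sphere (0 : EuclideanSpace ℝ (Fin N)) 1 → ℝ}
    (h : IsCapDirichletSolution N β l Θ) (hl : l * (l + N - 2) < μ)
    (hpos : ∀ s ∈ Icc 0 (capHeight β), 0 < capProfile c μ s) : False := by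
  obtain ⟨q, hq, hne⟩ := h.nontrivial
  wlog hq0 : 0 < Θ q generalizing Θ
  · exact this h.neg (neg_ne_zero.2 hne)
      (neg_pos.2 (lt_of_le_of_ne (not_lt.1 hq0) hne))
  set Φ : Metric.sphere (0 : EuclideanSpace ℝ (Fin N)) 1 → ℝ := zonal (capProfile c μ) with hΦ
  have hΦpos : ∀ p ∈ sphericalCap N β, 0 < Φ p := fun p hp =>
    hpos _ (zonalVariable_mem_Icc hβ hp)
  -- The least multiple of `Φ` lying above `Θ` touches it at `p`; as `m > 0`, the boundary condition
  -- puts `p` in the interior.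
  obtain ⟨p, hp, hmax⟩ := (isClosed_sphericalCap β).isCompact.exists_isMaxOn ⟨q, hq⟩
    (h.continuousOn.div (continuousOn_zonal_capProfile (μ := μ) hc hβ)
      fun p hp => (hΦpos p hp).ne')
  set m := Θ p / Φ p with hm
  have hle : ∀ p' ∈ sphericalCap N β, Θ p' / Φ p' ≤ m := fun p' hp' => hmax hp'
  have hm0 : 0 < m := (div_pos hq0 (hΦpos q hq)).trans_le (hle q hq)
  have hΘp : Θ p = m * Φ p := by rw [hm, div_mul_cancel₀ _ (hΦpos p hp).ne']
  have hint : p ∈ interior (sphericalCap N β) := by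
    by_contra hn
    have h0 := h.boundary p (by
      rw [(isClosed_sphericalCap β).frontier_eq]
      exact ⟨hp, hn⟩)
    exact (mul_pos hm0 (hΦpos p hp)).ne' (hΘp ▸ h0)
  have hlocmax : IsLocalMax (fun q => Θ q - m * Φ q) p := by
    filter_upwards [isOpen_interior.mem_nhds hint] with p' hp'
    have hp'' := interior_subset hp'
    have := (div_le_iff₀ (hΦpos p' hp'')).1 (hle p' hp'')
    linarith
  have hC₁ := h.contDiffAt p hint
  have hC₂ : ContDiffAt ℝ 2 (radialExtension Φ) (p : EuclideanSpace ℝ (Fin N)) :=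
    contDiffAt_radialExtension_zonal p (contDiffAt_capProfile hc (zonalVariable_abs_lt_one hβ hp))
  have hC₃ : ContDiffAt ℝ 2 (m • radialExtension Φ) (p : EuclideanSpace ℝ (Fin N)) :=
    contDiffAt_const.smul hC₂
  have hlap := (isLocalMax_radialExtension_sub_smul hlocmax).laplacian_nonpos (hC₁.sub hC₃)
  rw [hC₁.laplacian_sub hC₃, InnerProductSpace.laplacian_smul m hC₂] at hlap
  have e1 := h.equation p hint
  have e2 := sphereLaplacian_zonal_capProfile (μ := μ) hc hcN hβ hp
  simp only [sphereLaplacian] at e1 e2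
  rw [← hΦ] at e2
  rw [e2, smul_eq_mul] at hlap
  -- This is the Laplacian of `Θ - m Φ` at `p`, which the local maximum makes nonpositive.
  have e3 : 0 < (μ - l * (l + N - 2)) * Θ p :=
    mul_pos (sub_pos.2 hl) (hΘp ▸ mul_pos hm0 (hΦpos p hp))
  have e4 : m * -(μ * Φ p) = -(μ * Θ p) := by rw [hΘp]; ring
  linarith

/-- A zonal profile which vanishes at the boundary of the cap gives a solution. -/
theorem isCapDirichletSolution_zonal (hc : 1 / 2 ≤ c) (hcN : c = ((N : ℝ) - 1) / 2)
    (hβ : β ∈ Ioo 0 Real.pi) {l : ℝ} (hl : l * (l + N - 2) = μ)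
    (hzero : capProfile c μ (capHeight β) = 0) :
    IsCapDirichletSolution N β l (zonal (capProfile c μ)) where
  continuousOn := continuousOn_zonal_capProfile hc hβ
  contDiffAt p hp := contDiffAt_radialExtension_zonal p
    (contDiffAt_capProfile hc (zonalVariable_abs_lt_one hβ (interior_subset hp)))
  equation p hp := by
    rw [sphereLaplacian_zonal_capProfile hc hcN hβ (interior_subset hp), hl, neg_neg]
  boundary p hp := by
    rw [zonal, coord_eq_cos_of_mem_frontier hβ hp]
    exact hzero
  nontrivial := by
    refine ⟨⟨EuclideanSpace.single 0 1, by simp⟩, mem_sphericalCap_of_cos_lt hβ ?_, ?_⟩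
    · have h := Real.cos_lt_cos_of_nonneg_of_le_pi le_rfl hβ.2.le hβ.1
      simpa using h
    · simp [zonal, capProfile_zero]

end Cap

/-! ### From eigenvalues to exponents -/

theorem lemma1 (N : ℕ) [NeZero N] (hN : 2 ≤ N) (β : ℝ) (hβ : β ∈ Set.Ioo 0 Real.pi) :
    IsLeast (capExponents N β) (capCharacteristicValue N β) ∧
    (β < Real.pi / 2 → 1 < capCharacteristicValue N β) ∧
    (β = Real.pi / 2 → capCharacteristicValue N β = 1) ∧
    (Real.pi / 2 < β → capCharacteristicValue N β < 1) := by
  have hN' : (2 : ℝ) ≤ N := by exact_mod_cast hN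
  obtain ⟨c, hcN⟩ : ∃ c : ℝ, c = ((N : ℝ) - 1) / 2 := ⟨_, rfl⟩
  have hc : 1 / 2 ≤ c := by rw [hcN]; linarith
  have hb0 := capHeight_pos hβ
  have hb1 := capHeight_lt_one hβ
  obtain ⟨μ₀, hμ₀, hzero, hpos, hlt⟩ := exists_first_eigenvalue hc hb0 hb1
  obtain ⟨hcmp₁, hcmp₂, hcmp₃⟩ := first_eigenvalue_compare hc hb0 hb1 hμ₀ hzero hpos hlt
  -- The positive root of `l² + (N - 2) l - μ₀ = 0`.
  obtain ⟨l₀, hl₀, hl₀μ⟩ : ∃ l₀ : ℝ, 0 < l₀ ∧ l₀ * (l₀ + N - 2) = μ₀ := by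
    have hsq := Real.sq_sqrt (by positivity : 0 ≤ ((N : ℝ) - 2) ^ 2 + 4 * μ₀)
    refine ⟨(√(((N : ℝ) - 2) ^ 2 + 4 * μ₀) - (N - 2)) / 2, ?_, by linear_combination hsq / 4⟩
    have : (N : ℝ) - 2 < √(((N : ℝ) - 2) ^ 2 + 4 * μ₀) := Real.lt_sqrt_of_sq_lt (by linarith)
    linarith
  have hmono : ∀ {l l' : ℝ}, 0 < l → l < l' → l * (l + N - 2) < l' * (l' + N - 2) := by
    intro l l' hl hll'
    nlinarith
  have hone : (1 : ℝ) * (1 + N - 2) = 2 * c := by rw [hcN]; ring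
  have hleast : IsLeast (capExponents N β) l₀ := by
    refine ⟨⟨hl₀, _, isCapDirichletSolution_zonal hc hcN hβ hl₀μ hzero⟩, ?_⟩
    rintro l ⟨hl, Θ, hΘ⟩
    by_contra! hlt'
    -- The profile of `μ₀` itself vanishes on the boundary and is no barrier, so an intermediate
    -- exponent is used.
    obtain ⟨k, hlk, hkl₀⟩ := exists_between hlt'
    have hk : 0 < k := hl.trans hlk
    refine hΘ.false_of_barrier hc hcN hβ (hmono hl hlk) (hlt _ ?_ ?_)
    · exact mul_nonneg hk.le (by linarith)
    · rw [← hl₀μ]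
      exact hmono hk hkl₀
  have hchar : capCharacteristicValue N β = l₀ := hleast.csInf_eq
  rw [hchar]
  refine ⟨hleast, fun h => ?_, fun h => ?_, fun h => ?_⟩
  · have hcos := Real.cos_pos_of_mem_Ioo ⟨by linarith [hβ.1, Real.pi_pos], h⟩
    have h1 := hcmp₁ (by rw [capHeight]; linarith)
    by_contra! hle
    rcases hle.lt_or_eq with hle | hle
    · linarith [hmono hl₀ hle]
    · rw [hle] at hl₀μ
      linarith
  · have h1 := hcmp₂ (by rw [capHeight, h, Real.cos_pi_div_two, sub_zero])
    rcases lt_trichotomy l₀ 1 with h2 | h2 | h2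
    · linarith [hmono hl₀ h2]
    · exact h2
    · linarith [hmono one_pos h2]
  · have hcos := Real.cos_neg_of_pi_div_two_lt_of_lt h (by linarith [hβ.2, Real.pi_pos])
    have h1 := hcmp₃ (by rw [capHeight]; linarith)
    by_contra! hle
    rcases hle.lt_or_eq with hle | hle
    · linarith [hmono one_pos hle]
    · rw [← hle] at hl₀μ
      linarith
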